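/- Let $A>0$, let $s_{12}, s_{13}, \phi_1 \in C^\infty([0,A];\mathbb R)$ with $s_{12}>0$ and $s_{13}>0$ on $[0,A]$, and for $(\mu,\nu)\in\mathbb C^2$ consider on $[0,A]$ the radial equation $$-u'' + \big[\mu^2 s_{12}(x) + \nu^2 s_{13}(x) - \phi_1(x)\big]\,u = 0 .$$ (For a conformally Stäckel metric on $[0,A]\times\mathbb T^2$, $s_{12},s_{13}$ are entries of the first row of its Stäckel matrix, normalized to be positive, and this is the radial equation obtained by separation of variables in the Laplace equation.) Let $c_0,s_0,s_1$ be the solutions with $c_0(0)=1,\ c_0'(0)=0$; $s_0(0)=0,\ s_0'(0)=1$; $s_1(A)=0,\ s_1'(A)=1$. With the ($x$-independent) Wronskian $W(f,g)=fg'-f'g$, put $$\Delta(\mu^2,\nu^2)=W(s_0,s_1),\qquad D(\mu^2,\nu^2)=W(c_0,s_1).$$ Let $\tilde A,\tilde s_{12},\tilde s_{13},\tilde\phi_1$ be a second set of data with the same properties, with corresponding functions $\tilde\Delta,\tilde D$, and let $$F(\mu,\nu)=D(\mu^2,\nu^2)\,\tilde\Delta(\mu^2,\nu^2)-\tilde D(\mu^2,\nu^2)\,\Delta(\mu^2,\nu^2).$$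 **Proposition 3.1.** There exist constants $\bar A,\bar B,C>0$ (depending only on the two sets of data) such that for all $(\mu,\nu)\in\mathbb C^2$ $$|D(\mu^2,\nu^2)|,\ |\Delta(\mu^2,\nu^2)|,\ |\tilde D(\mu^2,\nu^2)|,\ |\tilde\Delta(\mu^2,\nu^2)|\ \le\ C\,e^{\frac{\bar A}{2}|\operatorname{Re}\mu|+\frac{\bar B}{2}|\operatorname{Re}\nu|},$$ and $$|F(\mu,\nu)|\ \le\ C\,e^{\bar A|\operatorname{Re}\mu|+\bar B|\operatorname{Re}\nu|}.$$ -/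

import Mathlib

open scoped ContDiff

/-- The radial part of a conformally Stäckel cylinder `[0, A] × 𝕋²`: the length `A > 0`, the entries
`s₁₂, s₁₃` of the first row of the Stäckel matrix, and the function `φ₁`. They are smooth on
`[0, A]`, and the Stäckel matrix is normalized so that `s₁₂, s₁₃ > 0`. Values outside `[0, A]` play
no role. -/
structure RadialData where
  A : ℝ
  s12 : ℝ → ℝ
  s13 : ℝ → ℝ
  phi1 : ℝ → ℝ
  A_pos : 0 < A
  s12_smooth : ContDiffOn ℝ ∞ s12 (Set.Icc 0 A)
  s13_smooth : ContDiffOn ℝ ∞ s13 (Set.Icc 0 A)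
  phi1_smooth : ContDiffOn ℝ ∞ phi1 (Set.Icc 0 A)
  s12_pos : ∀ x ∈ Set.Icc 0 A, 0 < s12 x
  s13_pos : ∀ x ∈ Set.Icc 0 A, 0 < s13 x

namespace RadialData

/-- The coefficient `z s₁₂ + w s₁₃ - φ₁` of the radial equation, with `z = μ²` and `w = ν²`. -/
noncomputable def potential (P : RadialData) (z w : ℂ) (x : ℝ) : ℂ :=
  z * (P.s12 x : ℂ) + w * (P.s13 x : ℂ) - (P.phi1 x : ℂ)

/-- The derivative on `[0, A]` (one-sided at the end points). -/
noncomputable def dx (P : RadialData) (u : ℝ → ℂ) : ℝ → ℂ :=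
  derivWithin u (Set.Icc 0 P.A)

/-- `u` is a classical solution on `[0, A]` of `-u'' + (z s₁₂ + w s₁₃ - φ₁) u = 0`. -/
def IsSolution (P : RadialData) (z w : ℂ) (u : ℝ → ℂ) : Prop :=
  DifferentiableOn ℝ u (Set.Icc 0 P.A) ∧
  DifferentiableOn ℝ (P.dx u) (Set.Icc 0 P.A) ∧
  ∀ x ∈ Set.Icc 0 P.A, -(P.dx (P.dx u) x) + P.potential z w x * u x = 0

/-- The Wronskian `W(f, g) = f g' - f' g` at the point `x`. -/
noncomputable def wronskian (P : RadialData) (f g : ℝ → ℂ) (x : ℝ) : ℂ :=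
  f x * P.dx g x - P.dx f x * g x

/-- Global existence for linear differential equations. -/
theorem exists_linear_ode {E : Type*} [NormedAddCommGroup E] [NormedSpace ℝ E] [CompleteSpace E]
    (M : ℝ → E →L[ℝ] E) (hM : Continuous M) {K : ℝ} (hK : ∀ t, ‖M t‖ ≤ K) (x0 : ℝ) (e : E) :
    ∃ y : ℝ → E, y x0 = e ∧ ∀ t, HasDerivAt y (M t (y t)) t := by
  have hK0 : 0 ≤ K := (norm_nonneg _).trans (hK 0)
  let Y : ℕ → ℝ → E := fun n => Nat.rec (fun _ => e) (fun _ y t => ∫ s in x0..t, M s (y s)) n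
  have hY0 : ∀ t, Y 0 t = e := fun t => rfl
  have hYs : ∀ n t, Y (n + 1) t = ∫ s in x0..t, M s (Y n s) := fun n t => rfl
  have hcont : ∀ n, Continuous (Y n) := by
    intro n
    induction n with
    | zero => exact continuous_const
    | succ n ih =>
      have h : Continuous fun s => M s (Y n s) := hM.clm_apply ih
      exact intervalIntegral.continuous_primitive (fun a b => h.intervalIntegrable a b) x0
  have hder : ∀ n t, HasDerivAt (Y (n + 1)) (M t (Y n t)) t := by
    intro n t
    have h : Continuous fun s => M s (Y n s) := hM.clm_apply (hcont n)
    exact intervalIntegral.integral_hasDerivAt_right (h.intervalIntegrable _ _)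
      h.stronglyMeasurable.stronglyMeasurableAtFilter h.continuousAt
  have hbd : ∀ n t, ‖Y n t‖ ≤ ‖e‖ * ((K * |t - x0|) ^ n / n.factorial) := by
    intro n
    induction n with
    | zero => intro t; simp [hY0]
    | succ n ih =>
      intro t
      rw [hYs]
      have h : Continuous fun s => M s (Y n s) := hM.clm_apply (hcont n)
      have hc : Continuous fun s : ℝ => K * ‖e‖ * K ^ n / n.factorial * |s - x0| ^ n := by fun_prop
      calc ‖∫ s in x0..t, M s (Y n s)‖
          ≤ ∫ s in Set.uIoc x0 t, ‖M s (Y n s)‖ :=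
            intervalIntegral.norm_integral_le_integral_norm_uIoc
        _ ≤ ∫ s in Set.uIoc x0 t, K * ‖e‖ * K ^ n / n.factorial * |s - x0| ^ n := by
            refine MeasureTheory.setIntegral_mono
              (h.norm.intervalIntegrable x0 t).def' (hc.intervalIntegrable x0 t).def' ?_
            intro s
            calc ‖M s (Y n s)‖ ≤ ‖M s‖ * ‖Y n s‖ := (M s).le_opNorm _
              _ ≤ K * (‖e‖ * ((K * |s - x0|) ^ n / n.factorial)) :=
                  mul_le_mul (hK s) (ih s) (norm_nonneg _) hK0
              _ = _ := by rw [mul_pow]; ring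
        _ = ‖e‖ * ((K * |t - x0|) ^ (n + 1) / (n + 1).factorial) := by
            rw [MeasureTheory.integral_const_mul, integral_pow_abs_sub_uIoc, Nat.factorial_succ]
            push_cast
            have h1 : (n.factorial : ℝ) ≠ 0 := by positivity
            have h2 : (n : ℝ) + 1 ≠ 0 := by positivity
            field_simp
            ring
  have hsum : ∀ r : ℝ, Summable fun n : ℕ => ‖e‖ * (r ^ n / n.factorial) := fun r =>
    (Real.summable_pow_div_factorial r).mul_left _
  have hYsum : ∀ t, Summable fun n => Y n t := fun t =>
    Summable.of_norm_bounded (hsum (K * |t - x0|)) (fun n => hbd n t)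
  have hshift : ∀ t, ∑' n, Y n t = e + ∑' n, Y (n + 1) t := fun t => by
    rw [(hYsum t).tsum_eq_zero_add, hY0]
  refine ⟨fun t => ∑' n, Y n t, ?_, ?_⟩
  · simp [hshift, hYs]
  · intro t
    have hfun : (fun t => ∑' n, Y n t) = fun t => e + ∑' n, Y (n + 1) t := funext hshift
    have hx0 : x0 ∈ Metric.ball x0 (|t - x0| + 1) := Metric.mem_ball_self (by positivity)
    have ht : t ∈ Metric.ball x0 (|t - x0| + 1) := by
      rw [Metric.mem_ball, Real.dist_eq]; linarith
    have key := hasDerivAt_tsum_of_isPreconnected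
      (g := fun n => Y (n + 1)) (g' := fun n t => M t (Y n t))
      ((hsum (K * (|t - x0| + 1))).mul_left K) Metric.isOpen_ball
      (convex_ball x0 (|t - x0| + 1)).isPreconnected (fun n y _ => hder n y)
      (fun n y hy => ?_) hx0 ((summable_nat_add_iff 1).2 (hYsum x0)) ht
    · have h2 : ∑' n, M t (Y n t) = M t (∑' n, Y n t) := ((M t).map_tsum (hYsum t)).symm
      rw [h2] at key
      rw [hfun]
      simpa [← hshift t] using key.const_add e
    · rw [Metric.mem_ball, Real.dist_eq] at hy
      calc ‖M y (Y n y)‖ ≤ ‖M y‖ * ‖Y n y‖ := (M y).le_opNorm _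
        _ ≤ K * (‖e‖ * ((K * |y - x0|) ^ n / n.factorial)) :=
            mul_le_mul (hK y) (hbd n y) (norm_nonneg _) hK0
        _ ≤ K * (‖e‖ * ((K * (|t - x0| + 1)) ^ n / n.factorial)) := by gcongr

/-- Every Cauchy problem at a point of `[0, A]` has a classical solution on `[0, A]`. -/
theorem exists_solution (P : RadialData) (z w : ℂ) (x0 : ℝ) (hx0 : x0 ∈ Set.Icc 0 P.A) (a b : ℂ) :
    ∃ u : ℝ → ℂ, P.IsSolution z w u ∧ u x0 = a ∧ P.dx u x0 = b := by
  have hA := P.A_pos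
  have hq : ContinuousOn (P.potential z w) (Set.Icc 0 P.A) := by
    have h1 := P.s12_smooth.continuousOn
    have h2 := P.s13_smooth.continuousOn
    have h3 := P.phi1_smooth.continuousOn
    unfold potential
    exact ((continuousOn_const.mul (Complex.continuous_ofReal.comp_continuousOn h1)).add
      (continuousOn_const.mul (Complex.continuous_ofReal.comp_continuousOn h2))).sub
      (Complex.continuous_ofReal.comp_continuousOn h3)
  let q : ℝ → ℂ := Set.IccExtend hA.le ((Set.Icc 0 P.A).domRestrict (P.potential z w))
  have hqc : Continuous q := (continuousOn_iff_continuous_domRestrict.1 hq).Icc_extend'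
  have hqe : ∀ x ∈ Set.Icc 0 P.A, q x = P.potential z w x := fun x hx => by
    exact Set.IccExtend_of_mem hA.le _ hx
  obtain ⟨k, hk⟩ : ∃ k, ∀ x, ‖q x‖ ≤ k := by
    obtain ⟨k, hk⟩ := isCompact_Icc.exists_bound_of_continuousOn hq
    exact ⟨k, fun x => hk _ (Set.projIcc 0 P.A hA.le x).2⟩
  let N0 : ℂ × ℂ →L[ℝ] ℂ × ℂ :=
    (ContinuousLinearMap.inl ℝ ℂ ℂ).comp (ContinuousLinearMap.snd ℝ ℂ ℂ)
  let N1 : ℂ × ℂ →L[ℝ] ℂ × ℂ :=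
    (ContinuousLinearMap.inr ℝ ℂ ℂ).comp (ContinuousLinearMap.fst ℝ ℂ ℂ)
  let M : ℝ → ℂ × ℂ →L[ℝ] ℂ × ℂ := fun t => N0 + q t • N1
  have hMc : Continuous M := continuous_const.add (hqc.smul continuous_const)
  have hMb : ∀ t, ‖M t‖ ≤ ‖N0‖ + k * ‖N1‖ := fun t =>
    (norm_add_le _ _).trans (add_le_add le_rfl ((norm_smul_le (q t) N1).trans
      (mul_le_mul_of_nonneg_right (hk t) (norm_nonneg N1))))
  obtain ⟨y, hy0, hy⟩ := exists_linear_ode M hMc hMb x0 (a, b)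
  have hfst : ∀ t, HasDerivAt (fun t => (y t).1) (y t).2 t := fun t => by
    have h := (ContinuousLinearMap.fst ℝ ℂ ℂ).hasFDerivAt.comp_hasDerivAt t (hy t)
    simpa [M, N0, N1, Function.comp_def] using h
  have hsnd : ∀ t, HasDerivAt (fun t => (y t).2) (q t * (y t).1) t := fun t => by
    have h := (ContinuousLinearMap.snd ℝ ℂ ℂ).hasFDerivAt.comp_hasDerivAt t (hy t)
    simpa [M, N0, N1, Function.comp_def] using h
  have hun : ∀ x ∈ Set.Icc 0 P.A, UniqueDiffWithinAt ℝ (Set.Icc 0 P.A) x :=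
    uniqueDiffOn_Icc hA
  have hdx : ∀ x ∈ Set.Icc 0 P.A, P.dx (fun t => (y t).1) x = (y x).2 := fun x hx =>
    (hfst x).hasDerivWithinAt.derivWithin (hun x hx)
  have hdd : ∀ x ∈ Set.Icc 0 P.A, HasDerivWithinAt (P.dx fun t => (y t).1)
      (q x * (y x).1) (Set.Icc 0 P.A) x := fun x hx =>
    (hsnd x).hasDerivWithinAt.congr hdx (hdx x hx)
  refine ⟨fun t => (y t).1, ⟨fun x _ => (hfst x).differentiableAt.differentiableWithinAt,
    fun x hx => (hdd x hx).differentiableWithinAt, fun x hx => ?_⟩, by simp [hy0], ?_⟩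
  · have h : P.dx (P.dx fun t => (y t).1) x = q x * (y x).1 :=
      (hdd x hx).derivWithin (hun x hx)
    rw [h, hqe x hx]
    ring
  · rw [hdx x0 hx0, hy0]

/-- The Wronskian of two solutions is constant on `[0, A]`. -/
theorem wronskian_eq (P : RadialData) {z w : ℂ} {f g : ℝ → ℂ} (hf : P.IsSolution z w f)
    (hg : P.IsSolution z w g) {x : ℝ} (hx : x ∈ Set.Icc 0 P.A) :
    P.wronskian f g x = P.wronskian f g 0 := by
  have hd : ∀ t ∈ Set.Icc 0 P.A,
      HasDerivWithinAt (P.wronskian f g) 0 (Set.Icc 0 P.A) t := by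
    intro t ht
    have f1 : HasDerivWithinAt f (P.dx f t) _ t := (hf.1 t ht).hasDerivWithinAt
    have g1 : HasDerivWithinAt g (P.dx g t) _ t := (hg.1 t ht).hasDerivWithinAt
    have f2 : HasDerivWithinAt (P.dx f) (P.dx (P.dx f) t) _ t := (hf.2.1 t ht).hasDerivWithinAt
    have g2 : HasDerivWithinAt (P.dx g) (P.dx (P.dx g) t) _ t := (hg.2.1 t ht).hasDerivWithinAt
    refine ((f1.mul g2).sub (f2.mul g1)).congr_deriv ?_
    linear_combination g t * hf.2.2 t ht - f t * hg.2.2 t ht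
  refine (convex_Icc 0 P.A).is_const_of_fderivWithin_eq_zero (𝕜 := ℝ)
    (fun t ht => (hd t ht).differentiableWithinAt) (fun t ht => ?_) hx
    (Set.left_mem_Icc.2 P.A_pos.le)
  have h := (hd t ht).hasFDerivWithinAt.fderivWithin (uniqueDiffOn_Icc P.A_pos t ht)
  rw [h]
  ext
  simp

/-- The solution `u` of the radial equation with Cauchy data `u(0) = a`, `u'(0) = b`. -/
noncomputable def solAtZero (P : RadialData) (a b z w : ℂ) : ℝ → ℂ :=
  Classical.choose (P.exists_solution z w 0 (Set.left_mem_Icc.2 P.A_pos.le) a b)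

/-- The solution `u` of the radial equation with Cauchy data `u(A) = a`, `u'(A) = b`. -/
noncomputable def solAtA (P : RadialData) (a b z w : ℂ) : ℝ → ℂ :=
  Classical.choose (P.exists_solution z w P.A (Set.right_mem_Icc.2 P.A_pos.le) a b)

/-- `c₀(0) = 1`, `c₀'(0) = 0`. -/
noncomputable def c0 (P : RadialData) (z w : ℂ) : ℝ → ℂ := P.solAtZero 1 0 z w

/-- `s₀(0) = 0`, `s₀'(0) = 1`. -/
noncomputable def s0 (P : RadialData) (z w : ℂ) : ℝ → ℂ := P.solAtZero 0 1 z w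

/-- `s₁(A) = 0`, `s₁'(A) = 1`. -/
noncomputable def s1 (P : RadialData) (z w : ℂ) : ℝ → ℂ := P.solAtA 0 1 z w

theorem c0_spec (P : RadialData) (z w : ℂ) :
    P.IsSolution z w (P.c0 z w) ∧ P.c0 z w 0 = 1 ∧ P.dx (P.c0 z w) 0 = 0 :=
  Classical.choose_spec (P.exists_solution z w 0 (Set.left_mem_Icc.2 P.A_pos.le) 1 0)

theorem s0_spec (P : RadialData) (z w : ℂ) :
    P.IsSolution z w (P.s0 z w) ∧ P.s0 z w 0 = 0 ∧ P.dx (P.s0 z w) 0 = 1 :=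
  Classical.choose_spec (P.exists_solution z w 0 (Set.left_mem_Icc.2 P.A_pos.le) 0 1)

theorem s1_spec (P : RadialData) (z w : ℂ) :
    P.IsSolution z w (P.s1 z w) ∧ P.s1 z w P.A = 0 ∧ P.dx (P.s1 z w) P.A = 1 :=
  Classical.choose_spec (P.exists_solution z w P.A (Set.right_mem_Icc.2 P.A_pos.le) 0 1)

/-- The characteristic function `Δ(z, w) = W(s₀, s₁)`. The Wronskian is constant on `[0, A]`; it is
evaluated at `0`. -/
noncomputable def Delta (P : RadialData) (z w : ℂ) : ℂ :=
  P.wronskian (P.s0 z w) (P.s1 z w) 0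

/-- The function `D(z, w) = W(c₀, s₁)`, so that `-D / Δ` is the Weyl-Titchmarsh function. -/
noncomputable def D (P : RadialData) (z w : ℂ) : ℂ :=
  P.wronskian (P.c0 z w) (P.s1 z w) 0

/-- `F(μ, ν) = D(μ², ν²) Δ'(μ², ν²) - D'(μ², ν²) Δ(μ², ν²)`, with a prime for the data `Q`. -/
noncomputable def F (P Q : RadialData) (μ ν : ℂ) : ℂ :=
  P.D (μ ^ 2) (ν ^ 2) * Q.Delta (μ ^ 2) (ν ^ 2) - Q.D (μ ^ 2) (ν ^ 2) * P.Delta (μ ^ 2) (ν ^ 2)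

end RadialData

/-!
The bounds follow from an energy estimate that is uniform in the spectral parameters. For a solution
`u` of `u'' = V u`, where `V = μ² s₁₂ + ν² s₁₃ - φ₁`, put

  `E = |u'|² + Λ |u|²`,  `Λ = |μ|² s₁₂ + |ν|² s₁₃ + 1`.

Then `E' = 2 Re (conj u' (V + Λ) u) + Λ' |u|²`. Since `μ² + |μ|² = 2 (Re μ) μ`, the sum `V + Λ` is
`2 (Re μ) μ s₁₂ + 2 (Re ν) ν s₁₃ + (1 - φ₁)`: the growth of `E` is driven by the real parts only, the
remaining factors `|μ|` and `|ν|` being absorbed by `Λ`. Together with `|Λ'| ≤ L Λ`, which holds with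
`L` independent of `μ, ν` because `s₁₂, s₁₃` are bounded below, this gives `E' ≤ K E` with
`K = 2 S (|Re μ| + |Re ν|) + const` (`RadialData.two_inner_add_le`), hence
`E(A) ≤ E(0) exp (K A)` (`le_mul_exp_of_hasDerivWithinAt_le`).

Evaluating the Wronskians at `A` shows `Δ = s₀(A)` and `D = c₀(A)`. For `s₀` the energy at `0` is `1`,
for `c₀` it is `Λ(0)`, and `Λ(0) / Λ(A)` is bounded uniformly in `μ, ν`; in both cases
`|u(A)|² ≤ E(A) / Λ(A)` gives the claim. The bound on `F` is the product of these bounds.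
-/

open Set

/-- Grönwall's inequality for a function differentiable on `[0, A]`. -/
theorem le_mul_exp_of_hasDerivWithinAt_le {f f' : ℝ → ℝ} {A K : ℝ} (hA : 0 ≤ A)
    (hf : ∀ x ∈ Icc 0 A, HasDerivWithinAt f (f' x) (Icc 0 A) x)
    (hle : ∀ x ∈ Icc 0 A, f' x ≤ K * f x) : f A ≤ f 0 * Real.exp (K * A) := by
  have hg : ∀ x ∈ Icc 0 A, HasDerivWithinAt (fun x => f x * Real.exp (-(K * x)))
      ((f' x - K * f x) * Real.exp (-(K * x))) (Icc 0 A) x := by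
    intro x hx
    have he : HasDerivAt (fun x => Real.exp (-(K * x))) (Real.exp (-(K * x)) * -(K * 1)) x :=
      (((hasDerivAt_id x).const_mul K).neg).exp
    exact ((hf x hx).mul he.hasDerivWithinAt).congr_deriv (by ring)
  have hanti : AntitoneOn (fun x => f x * Real.exp (-(K * x))) (Icc 0 A) := by
    refine antitoneOn_of_hasDerivWithinAt_nonpos (convex_Icc 0 A)
      (fun x hx => (hg x hx).continuousWithinAt)
      (fun x hx => (hg x (interior_subset hx)).mono interior_subset) (fun x hx => ?_)
    exact mul_nonpos_of_nonpos_of_nonneg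
      (sub_nonpos.2 (hle x (interior_subset hx))) (Real.exp_nonneg _)
  have h := hanti (left_mem_Icc.2 hA) (right_mem_Icc.2 hA) hA
  simp only [mul_zero, neg_zero, Real.exp_zero, mul_one] at h
  calc f A = f A * Real.exp (-(K * A)) * Real.exp (K * A) := by
        rw [mul_assoc, ← Real.exp_add]; simp
    _ ≤ _ := mul_le_mul_of_nonneg_right h (Real.exp_nonneg _)

/-- A positive smooth function on `[0, A]` has bounded values, bounded logarithmic derivative, and
bounded ratios of values. -/
theorem ContDiffOn.exists_bounds_of_pos {A : ℝ} (hA : 0 < A) {s : ℝ → ℝ}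
    (hs : ContDiffOn ℝ ∞ s (Icc 0 A)) (hpos : ∀ x ∈ Icc 0 A, 0 < s x) :
    ∃ M, 1 ≤ M ∧ ∀ x ∈ Icc 0 A, s x ≤ M ∧ |derivWithin s (Icc 0 A) x| ≤ M * s x ∧
      ∀ y ∈ Icc 0 A, s x ≤ M * s y := by
  obtain ⟨b, hb⟩ := isCompact_Icc.exists_bound_of_continuousOn hs.continuousOn
  obtain ⟨d, hd⟩ := isCompact_Icc.exists_bound_of_continuousOn
    (hs.continuousOn_derivWithin (uniqueDiffOn_Icc hA) (by simp))
  obtain ⟨x₀, hx₀, hmin⟩ := isCompact_Icc.exists_isMinOn (nonempty_Icc.2 hA.le) hs.continuousOn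
  have hm := hpos x₀ hx₀
  set T := max 1 (max b d) with hT
  have hT1 : 1 ≤ T := le_max_left _ _
  have hTb : b ≤ T := (le_max_left _ _).trans (le_max_right _ _)
  have hTd : d ≤ T := (le_max_right _ _).trans (le_max_right _ _)
  have hTM : T ≤ max T (T / s x₀) := le_max_left _ _
  have key : ∀ y ∈ Icc 0 A, T ≤ max T (T / s x₀) * s y := fun y hy =>
    calc T = T / s x₀ * s x₀ := by field_simp
      _ ≤ max T (T / s x₀) * s y := by
        refine mul_le_mul (le_max_right _ _) (hmin hy) hm.le (by positivity)
  have hsT : ∀ x ∈ Icc 0 A, s x ≤ T := fun x hx => ((le_abs_self _).trans (hb x hx)).trans hTb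
  exact ⟨max T (T / s x₀), hT1.trans hTM, fun x hx => ⟨(hsT x hx).trans hTM,
    ((hd x hx).trans hTd).trans (key x hx), fun y hy => (hsT x hx).trans (key y hy)⟩⟩

namespace RadialData

/-- The weight `Λ = |μ|² s₁₂ + |ν|² s₁₃ + 1`. -/
noncomputable def weight (P : RadialData) (μ ν : ℂ) (x : ℝ) : ℝ :=
  ‖μ‖ ^ 2 * P.s12 x + ‖ν‖ ^ 2 * P.s13 x + 1

/-- The energy `|u'|² + Λ |u|²` of a function on `[0, A]`. -/
noncomputable def energy (P : RadialData) (μ ν : ℂ) (u : ℝ → ℂ) (x : ℝ) : ℝ :=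
  ‖P.dx u x‖ ^ 2 + P.weight μ ν x * ‖u x‖ ^ 2

theorem one_le_weight (P : RadialData) (μ ν : ℂ) {x : ℝ} (hx : x ∈ Icc 0 P.A) :
    1 ≤ P.weight μ ν x := by
  have h1 := (P.s12_pos x hx).le
  have h2 := (P.s13_pos x hx).le
  unfold weight
  have : 0 ≤ ‖μ‖ ^ 2 * P.s12 x + ‖ν‖ ^ 2 * P.s13 x := by positivity
  linarith

theorem hasDerivWithinAt_weight (P : RadialData) (μ ν : ℂ) {x : ℝ} (hx : x ∈ Icc 0 P.A) :
    HasDerivWithinAt (P.weight μ ν)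
      (‖μ‖ ^ 2 * derivWithin P.s12 (Icc 0 P.A) x + ‖ν‖ ^ 2 * derivWithin P.s13 (Icc 0 P.A) x)
      (Icc 0 P.A) x := by
  have h1 := (P.s12_smooth.differentiableOn (by simp) x hx).hasDerivWithinAt
  have h2 := (P.s13_smooth.differentiableOn (by simp) x hx).hasDerivWithinAt
  exact ((h1.const_mul _).add (h2.const_mul _)).add_const _

theorem hasDerivWithinAt_energy (P : RadialData) (μ ν : ℂ) {u : ℝ → ℂ}
    (hu : P.IsSolution (μ ^ 2) (ν ^ 2) u) {x : ℝ} (hx : x ∈ Icc 0 P.A) :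
    HasDerivWithinAt (P.energy μ ν u)
      (2 * inner ℝ (P.dx u x) ((P.potential (μ ^ 2) (ν ^ 2) x + P.weight μ ν x) * u x) +
        (‖μ‖ ^ 2 * derivWithin P.s12 (Icc 0 P.A) x +
          ‖ν‖ ^ 2 * derivWithin P.s13 (Icc 0 P.A) x) * ‖u x‖ ^ 2) (Icc 0 P.A) x := by
  have h1 : HasDerivWithinAt u (P.dx u x) (Icc 0 P.A) x := (hu.1 x hx).hasDerivWithinAt
  have h2 : HasDerivWithinAt (P.dx u) (P.dx (P.dx u) x) (Icc 0 P.A) x :=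
    (hu.2.1 x hx).hasDerivWithinAt
  have h3 : P.dx (P.dx u) x = P.potential (μ ^ 2) (ν ^ 2) x * u x := by
    linear_combination -hu.2.2 x hx
  rw [h3] at h2
  refine (h2.norm_sq.add ((P.hasDerivWithinAt_weight μ ν hx).mul h1.norm_sq)).congr_deriv ?_
  have h4 : (P.weight μ ν x : ℂ) * u x = P.weight μ ν x • u x := by simp
  rw [add_mul (P.potential _ _ x), inner_add_right, h4, inner_smul_right, real_inner_comm (u x)]
  ring

/-- The identity behind the energy estimate: adding `Λ` to the potential leaves only terms with a
factor `Re μ`, a factor `Re ν`, or no spectral parameter. -/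
theorem potential_add_weight (P : RadialData) (μ ν : ℂ) (x : ℝ) :
    P.potential (μ ^ 2) (ν ^ 2) x + P.weight μ ν x =
      2 * μ.re * μ * P.s12 x + 2 * ν.re * ν * P.s13 x + (1 - P.phi1 x) := by
  have h : ∀ z : ℂ, z ^ 2 + (‖z‖ : ℂ) ^ 2 = 2 * z.re * z := fun z => by
    have hz := Complex.add_conj z
    push_cast at hz
    rw [← Complex.mul_conj']
    linear_combination z * hz
  unfold potential weight
  push_cast
  linear_combination (P.s12 x : ℂ) * h μ + (P.s13 x : ℂ) * h ν

/-- The derivative of the energy is at most `2 S (|Re μ| + |Re ν|) + L + G` times the energy, stated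
for the values `v = u'(x)`, `w = u(x)`, `d₁ = s₁₂'(x)`, `d₂ = s₁₃'(x)`. -/
theorem two_inner_add_le (P : RadialData) (μ ν v w : ℂ) {x S L G d₁ d₂ : ℝ} (hS : 1 ≤ S)
    (hL : 0 ≤ L) (hs₁ : 0 ≤ P.s12 x) (hs₂ : 0 ≤ P.s13 x) (hS₁ : P.s12 x ≤ S) (hS₂ : P.s13 x ≤ S)
    (hd₁ : |d₁| ≤ L * P.s12 x) (hd₂ : |d₂| ≤ L * P.s13 x) (hG : |1 - P.phi1 x| ≤ G) :
    2 * inner ℝ v ((P.potential (μ ^ 2) (ν ^ 2) x + P.weight μ ν x) * w) +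
        (‖μ‖ ^ 2 * d₁ + ‖ν‖ ^ 2 * d₂) * ‖w‖ ^ 2 ≤
      (2 * S * (|μ.re| + |ν.re|) + L + G) * (‖v‖ ^ 2 + P.weight μ ν x * ‖w‖ ^ 2) := by
  set E := ‖v‖ ^ 2 + P.weight μ ν x * ‖w‖ ^ 2 with hE
  have hEe : E = ‖v‖ ^ 2 + ‖μ‖ ^ 2 * P.s12 x * ‖w‖ ^ 2 + ‖ν‖ ^ 2 * P.s13 x * ‖w‖ ^ 2 +
      ‖w‖ ^ 2 := by rw [hE, weight]; ring
  have hp₁ : 0 ≤ ‖μ‖ ^ 2 * P.s12 x * ‖w‖ ^ 2 := by positivity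
  have hp₂ : 0 ≤ ‖ν‖ ^ 2 * P.s13 x * ‖w‖ ^ 2 := by positivity
  have hG0 : 0 ≤ G := (abs_nonneg _).trans hG
  -- `2 |v| (|z| s |w|) ≤ |v|² + s (s |z|² |w|²) ≤ S E`
  have absorb : ∀ (z : ℂ) (s : ℝ), 0 ≤ s → s ≤ S → ‖v‖ ^ 2 + ‖z‖ ^ 2 * s * ‖w‖ ^ 2 ≤ E →
      2 * ‖v‖ * (‖z‖ * s * ‖w‖) ≤ S * E := by
    intro z s hs hsS hzE
    calc 2 * ‖v‖ * (‖z‖ * s * ‖w‖) ≤ ‖v‖ ^ 2 + (‖z‖ * s * ‖w‖) ^ 2 := two_mul_le_add_sq _ _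
      _ = 1 * ‖v‖ ^ 2 + s * (‖z‖ ^ 2 * s * ‖w‖ ^ 2) := by ring
      _ ≤ S * ‖v‖ ^ 2 + S * (‖z‖ ^ 2 * s * ‖w‖ ^ 2) := by gcongr
      _ = S * (‖v‖ ^ 2 + ‖z‖ ^ 2 * s * ‖w‖ ^ 2) := by ring
      _ ≤ S * E := by gcongr
  have h₁ := absorb μ _ hs₁ hS₁ (by linarith [sq_nonneg ‖w‖])
  have h₂ := absorb ν _ hs₂ hS₂ (by linarith [sq_nonneg ‖w‖])
  have h₃ : 2 * ‖v‖ * ‖w‖ ≤ E := (two_mul_le_add_sq _ _).trans (by linarith)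
  have hinner : inner ℝ v ((P.potential (μ ^ 2) (ν ^ 2) x + P.weight μ ν x) * w) ≤
      ‖v‖ * ((2 * |μ.re| * ‖μ‖ * P.s12 x + 2 * |ν.re| * ‖ν‖ * P.s13 x + G) * ‖w‖) := by
    refine (real_inner_le_norm _ _).trans ?_
    rw [potential_add_weight, norm_mul]
    gcongr
    refine (norm_add₃_le).trans (add_le_add_three ?_ ?_ ?_)
    · simp [abs_of_nonneg hs₁]
    · simp [abs_of_nonneg hs₂]
    · rw [← Complex.ofReal_one, ← Complex.ofReal_sub, Complex.norm_real]
      exact hG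
  have hd : (‖μ‖ ^ 2 * d₁ + ‖ν‖ ^ 2 * d₂) * ‖w‖ ^ 2 ≤ L * E :=
    calc (‖μ‖ ^ 2 * d₁ + ‖ν‖ ^ 2 * d₂) * ‖w‖ ^ 2
        ≤ (‖μ‖ ^ 2 * (L * P.s12 x) + ‖ν‖ ^ 2 * (L * P.s13 x)) * ‖w‖ ^ 2 := by
          gcongr
          · exact (le_abs_self _).trans hd₁
          · exact (le_abs_self _).trans hd₂
      _ = L * (‖μ‖ ^ 2 * P.s12 x * ‖w‖ ^ 2 + ‖ν‖ ^ 2 * P.s13 x * ‖w‖ ^ 2) := by ring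
      _ ≤ L * E := by
          gcongr
          linarith [sq_nonneg ‖w‖, sq_nonneg ‖v‖]
  have e₁ := mul_le_mul_of_nonneg_left h₁ (abs_nonneg μ.re)
  have e₂ := mul_le_mul_of_nonneg_left h₂ (abs_nonneg ν.re)
  have e₃ := mul_le_mul_of_nonneg_left h₃ hG0
  linarith

/-- A solution with `|u(0)| ≤ 1` and `|u'(0)| ≤ 1` is bounded at `A` by an exponential in
`|Re μ| + |Re ν|`, with constants that depend only on the data. -/
theorem exists_norm_solution_le (P : RadialData) :
    ∃ B C : ℝ, 0 < B ∧ 0 < C ∧ ∀ (μ ν : ℂ) (u : ℝ → ℂ), P.IsSolution (μ ^ 2) (ν ^ 2) u →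
      ‖u 0‖ ≤ 1 → ‖P.dx u 0‖ ≤ 1 →
      ‖u P.A‖ ≤ C * Real.exp (B / 2 * |μ.re| + B / 2 * |ν.re|) := by
  have hA := P.A_pos
  obtain ⟨M₁, hM₁, h₁⟩ := P.s12_smooth.exists_bounds_of_pos hA P.s12_pos
  obtain ⟨M₂, hM₂, h₂⟩ := P.s13_smooth.exists_bounds_of_pos hA P.s13_pos
  obtain ⟨G, hG⟩ := isCompact_Icc.exists_bound_of_continuousOn
    (continuousOn_const.sub P.phi1_smooth.continuousOn : ContinuousOn (fun x => 1 - P.phi1 x) _)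
  set M := max M₁ M₂
  have hM : 1 ≤ M := hM₁.trans (le_max_left _ _)
  have l₁ : M₁ ≤ M := le_max_left _ _
  have l₂ : M₂ ≤ M := le_max_right _ _
  have h0 : (0 : ℝ) ∈ Icc 0 P.A := left_mem_Icc.2 hA.le
  have hAm : P.A ∈ Icc 0 P.A := right_mem_Icc.2 hA.le
  refine ⟨2 * M * P.A, (1 + M) * Real.exp ((M + G) * P.A / 2), by positivity, by positivity, ?_⟩
  intro μ ν u hu hu0 hu1
  have hgr := le_mul_exp_of_hasDerivWithinAt_le hA.le
    (fun x hx => P.hasDerivWithinAt_energy μ ν hu hx) (K := 2 * M * (|μ.re| + |ν.re|) + M + G)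
    (fun x hx => by
      have p₁ := (P.s12_pos x hx).le
      have p₂ := (P.s13_pos x hx).le
      exact P.two_inner_add_le μ ν (P.dx u x) (u x) hM (by linarith) p₁ p₂
        ((h₁ x hx).1.trans l₁) ((h₂ x hx).1.trans l₂)
        ((h₁ x hx).2.1.trans (mul_le_mul_of_nonneg_right l₁ p₁))
        ((h₂ x hx).2.1.trans (mul_le_mul_of_nonneg_right l₂ p₂)) (hG x hx))
  have hWA := P.one_le_weight μ ν hAm
  have hW0 := P.one_le_weight μ ν h0
  -- the ratio of the weights at the two end points is bounded uniformly in `μ, ν`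
  have hratio : P.weight μ ν 0 ≤ M * P.weight μ ν P.A := by
    have r₁ : P.s12 0 ≤ M * P.s12 P.A := ((h₁ 0 h0).2.2 _ hAm).trans
      (mul_le_mul_of_nonneg_right l₁ (P.s12_pos _ hAm).le)
    have r₂ : P.s13 0 ≤ M * P.s13 P.A := ((h₂ 0 h0).2.2 _ hAm).trans
      (mul_le_mul_of_nonneg_right l₂ (P.s13_pos _ hAm).le)
    calc P.weight μ ν 0
        ≤ ‖μ‖ ^ 2 * (M * P.s12 P.A) + ‖ν‖ ^ 2 * (M * P.s13 P.A) + M := by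
          unfold weight; gcongr
      _ = M * P.weight μ ν P.A := by unfold weight; ring
  have hE0 : P.energy μ ν u 0 ≤ (1 + M) * P.weight μ ν P.A := by
    have a₁ : ‖P.dx u 0‖ ^ 2 ≤ 1 := pow_le_one₀ (norm_nonneg _) hu1
    have a₂ : ‖u 0‖ ^ 2 ≤ 1 := pow_le_one₀ (norm_nonneg _) hu0
    have a₃ : P.weight μ ν 0 * ‖u 0‖ ^ 2 ≤ P.weight μ ν 0 * 1 := by gcongr
    unfold energy
    linarith
  have hEA : P.weight μ ν P.A * ‖u P.A‖ ^ 2 ≤ P.energy μ ν u P.A :=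
    le_add_of_nonneg_left (sq_nonneg _)
  set K := 2 * M * (|μ.re| + |ν.re|) + M + G with hK
  have hsq : ‖u P.A‖ ^ 2 ≤ ((1 + M) * Real.exp (K * P.A / 2)) ^ 2 := by
    have hexp : Real.exp (K * P.A / 2) ^ 2 = Real.exp (K * P.A) := by
      rw [← Real.exp_nat_mul]; congr 1; push_cast; ring
    rw [mul_pow, hexp]
    refine le_of_mul_le_mul_left ?_ (zero_lt_one.trans_le hWA)
    calc P.weight μ ν P.A * ‖u P.A‖ ^ 2
        ≤ (1 + M) * P.weight μ ν P.A * Real.exp (K * P.A) :=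
          (hEA.trans hgr).trans (mul_le_mul_of_nonneg_right hE0 (Real.exp_nonneg _))
      _ = P.weight μ ν P.A * ((1 + M) * Real.exp (K * P.A)) := by ring
      _ ≤ P.weight μ ν P.A * ((1 + M) ^ 2 * Real.exp (K * P.A)) := by
          gcongr
          exact le_self_pow₀ (by linarith) two_ne_zero
  calc ‖u P.A‖ ≤ (1 + M) * Real.exp (K * P.A / 2) := le_of_sq_le_sq hsq (by positivity)
    _ = _ := by
      rw [mul_assoc, ← Real.exp_add, hK]
      congr 2
      ring

theorem Delta_eq (P : RadialData) (z w : ℂ) : P.Delta z w = P.s0 z w P.A := by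
  obtain ⟨h, h0, h1⟩ := P.s1_spec z w
  rw [Delta, ← P.wronskian_eq (P.s0_spec z w).1 h (right_mem_Icc.2 P.A_pos.le), wronskian, h0, h1]
  ring

theorem D_eq (P : RadialData) (z w : ℂ) : P.D z w = P.c0 z w P.A := by
  obtain ⟨h, h0, h1⟩ := P.s1_spec z w
  rw [D, ← P.wronskian_eq (P.c0_spec z w).1 h (right_mem_Icc.2 P.A_pos.le), wronskian, h0, h1]
  ring

theorem exists_norm_D_Delta_le (P : RadialData) :
    ∃ B C : ℝ, 0 < B ∧ 0 < C ∧ ∀ μ ν : ℂ,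
      ‖P.D (μ ^ 2) (ν ^ 2)‖ ≤ C * Real.exp (B / 2 * |μ.re| + B / 2 * |ν.re|) ∧
      ‖P.Delta (μ ^ 2) (ν ^ 2)‖ ≤ C * Real.exp (B / 2 * |μ.re| + B / 2 * |ν.re|) := by
  obtain ⟨B, C, hB, hC, h⟩ := P.exists_norm_solution_le
  refine ⟨B, C, hB, hC, fun μ ν => ⟨?_, ?_⟩⟩
  · obtain ⟨hc, h0, h1⟩ := P.c0_spec (μ ^ 2) (ν ^ 2)
    rw [D_eq]
    exact h μ ν _ hc (by simp [h0]) (by simp [h1])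
  · obtain ⟨hs, h0, h1⟩ := P.s0_spec (μ ^ 2) (ν ^ 2)
    rw [Delta_eq]
    exact h μ ν _ hs (by simp [h0]) (by simp [h1])

end RadialData

theorem proposition3p1 (P Q : RadialData) :
    ∃ Abar Bbar C : ℝ, 0 < Abar ∧ 0 < Bbar ∧ 0 < C ∧
      (∀ μ ν : ℂ,
        ‖P.D (μ ^ 2) (ν ^ 2)‖ ≤ C * Real.exp (Abar / 2 * |μ.re| + Bbar / 2 * |ν.re|) ∧
        ‖P.Delta (μ ^ 2) (ν ^ 2)‖ ≤ C * Real.exp (Abar / 2 * |μ.re| + Bbar / 2 * |ν.re|) ∧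
        ‖Q.D (μ ^ 2) (ν ^ 2)‖ ≤ C * Real.exp (Abar / 2 * |μ.re| + Bbar / 2 * |ν.re|) ∧
        ‖Q.Delta (μ ^ 2) (ν ^ 2)‖ ≤ C * Real.exp (Abar / 2 * |μ.re| + Bbar / 2 * |ν.re|)) ∧
      ∀ μ ν : ℂ,
        ‖RadialData.F P Q μ ν‖ ≤ C * Real.exp (Abar * |μ.re| + Bbar * |ν.re|) := by
  obtain ⟨B₁, C₁, hB₁, hC₁, h₁⟩ := P.exists_norm_D_Delta_le
  obtain ⟨B₂, C₂, hB₂, hC₂, h₂⟩ := Q.exists_norm_D_Delta_le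
  set B := max B₁ B₂
  set C := max C₁ C₂
  have hB : 0 < B := hB₁.trans_le (le_max_left _ _)
  have hC : 0 < C := hC₁.trans_le (le_max_left _ _)
  have m₁ : ∀ μ ν : ℂ, C₁ * Real.exp (B₁ / 2 * |μ.re| + B₁ / 2 * |ν.re|) ≤
      C * Real.exp (B / 2 * |μ.re| + B / 2 * |ν.re|) := fun μ ν => by
    gcongr <;> exact le_max_left _ _
  have m₂ : ∀ μ ν : ℂ, C₂ * Real.exp (B₂ / 2 * |μ.re| + B₂ / 2 * |ν.re|) ≤
      C * Real.exp (B / 2 * |μ.re| + B / 2 * |ν.re|) := fun μ ν => by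
    gcongr <;> exact le_max_right _ _
  have hle : C ≤ C + 2 * C ^ 2 := le_add_of_nonneg_right (by positivity)
  have hle' : ∀ μ ν : ℂ, C * Real.exp (B / 2 * |μ.re| + B / 2 * |ν.re|) ≤
      (C + 2 * C ^ 2) * Real.exp (B / 2 * |μ.re| + B / 2 * |ν.re|) := fun μ ν =>
    mul_le_mul_of_nonneg_right hle (Real.exp_nonneg _)
  refine ⟨B, B, C + 2 * C ^ 2, hB, hB, by positivity, fun μ ν =>
    ⟨((h₁ μ ν).1.trans (m₁ μ ν)).trans (hle' μ ν), ((h₁ μ ν).2.trans (m₁ μ ν)).trans (hle' μ ν),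
      ((h₂ μ ν).1.trans (m₂ μ ν)).trans (hle' μ ν), ((h₂ μ ν).2.trans (m₂ μ ν)).trans (hle' μ ν)⟩,
    fun μ ν => ?_⟩
  set e := Real.exp (B / 2 * |μ.re| + B / 2 * |ν.re|) with he
  have hsq : Real.exp (B * |μ.re| + B * |ν.re|) = e * e := by
    rw [he, ← Real.exp_add]
    congr 1
    ring
  rw [hsq]
  calc ‖RadialData.F P Q μ ν‖
      ≤ ‖P.D (μ ^ 2) (ν ^ 2)‖ * ‖Q.Delta (μ ^ 2) (ν ^ 2)‖ +
        ‖Q.D (μ ^ 2) (ν ^ 2)‖ * ‖P.Delta (μ ^ 2) (ν ^ 2)‖ := by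
        rw [RadialData.F, ← norm_mul, ← norm_mul]
        exact norm_sub_le _ _
    _ ≤ (C * e) * (C * e) + (C * e) * (C * e) := by
        gcongr
        · exact (h₁ μ ν).1.trans (m₁ μ ν)
        · exact (h₂ μ ν).2.trans (m₂ μ ν)
        · exact (h₂ μ ν).1.trans (m₂ μ ν)
        · exact (h₁ μ ν).2.trans (m₁ μ ν)
    _ = 2 * C ^ 2 * (e * e) := by ring
    _ ≤ (C + 2 * C ^ 2) * (e * e) := by
        gcongr
        exact le_add_of_nonneg_left hC.le
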